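/- Let $P$ be a finite $(\mathbf 3+\mathbf 1)$-free poset, i.e. $P$ has no elements $a<b<c$ and $d$ with $d$ incomparable to each of $a,b,c$. Let $\mathrm{inc}(P)$ be its incomparability graph, and let $X_{\mathrm{inc}(P)}(\mathbf x)=\sum_\kappa\prod_{v\in P}x_{\kappa(v)}$ be its chromatic symmetric function, the sum being over all proper colorings $\kappa$ of $\mathrm{inc}(P)$ by positive integers. Then $X_{\mathrm{inc}(P)}$ has a unique expansion $X_{\mathrm{inc}(P)}=\sum_\lambda c^P_\lambda e_\lambda$ with integer coefficients $c^P_\lambda$ (a finite sum over integer partitions $\lambda$) in the products $e_\lambda=e_{\lambda_1}e_{\lambda_2}\cdots$ of elementary symmetric functions, and for all integers $r,c\ge 0$, $$c^P_{(r^c)}=\#\{\text{standard cylindric } P\text{-tableaux of shape } (r^c)/\varnothing/0\}.$$ Here $(r^c)$ is the partition with $c$ parts equal to $r$ (the empty partition if $rc=0$). For a cylindric shape $\lambda/\mu/d$, that is, partitions $\mu\subset\lambda$ and an integer $d$ with $\max(\lambda'_1-\lambda'_{\lambda_1},\,\mu'_1-\mu'_{\lambda_1})\le d\le\lambda'_1$,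 where $'$ denotes the transpose, a filling $T$ of the skew diagram $\lambda/\mu$ with elements of a poset $Q$ is a *cylindric $Q$-tableau* if the filling $T^d$, obtained by gluing a copy of the first column of $T$ to the right of the last column of $T$, shifted up by $d$ cells, is a $Q$-tableau: entries satisfy $T^d(i,j)<_Q T^d(i+1,j)$ and $T^d(i,j)\not>_Q T^d(i,j+1)$ whenever both cells belong to the diagram. It is *standard* if it contains each element of $Q$ exactly once. For the shape $(r^c)/\varnothing/0$ this says that $T$ increases strictly down columns and that no entry is greater than the next entry of its row, the rows being read cyclically. Moreover, for all integers $r,c\ge 0$ the cylindric Schur function $s_{(r^c)/\varnothing/0}(\mathbf x)=\sum_T\prod_b x_{T(b)}$, summed over all cylindric $\mathbb Z_{>0}$-tableaux $T$ of shape $(r^c)/\varnothing/0$, equals the monomial symmetric function $m_{(r^c)}(\mathbf x)$. -/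

import Mathlib

noncomputable section

namespace CylPTab

/-! ### Posets and chromatic symmetric functions -/

/-- `P` has no induced subposet isomorphic to the disjoint union of a three-element chain
and a single element. -/
def ThreePlusOneFree (P : Type*) [PartialOrder P] : Prop :=
  ∀ a b c d : P, a < b → b < c →
    ¬ (IncompRel (· ≤ ·) a d ∧ IncompRel (· ≤ ·) b d ∧ IncompRel (· ≤ ·) c d)

/-- The incomparability graph of a poset. -/
def incGraph (P : Type*) [PartialOrder P] : SimpleGraph P where
  Adj a b := IncompRel (· ≤ ·) a b
  symm := ⟨fun _ _ h => ⟨h.2, h.1⟩⟩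
  loopless := ⟨fun _ h => h.1 le_rfl⟩

/-- The exponent vector of the monomial `∏ b, x_{f b}` attached to a filling or colouring `f`.
The variables are indexed by `ℕ`, so the colours are `0, 1, 2, …`. -/
def weight {B : Type*} [Fintype B] (f : B → ℕ) : ℕ →₀ ℕ :=
  ∑ b, Finsupp.single (f b) 1

/-- The chromatic symmetric function `∑ κ, ∏ v, x_{κ v}` over all proper colourings `κ`, a formal
power series in countably many variables: the coefficient of a monomial is the (finite) number of
proper colourings with that weight. -/
def chromaticSymm {V : Type*} [Fintype V] (G : SimpleGraph V) : MvPowerSeries ℕ ℤ :=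
  fun m => (Nat.card {κ : G.Coloring ℕ // weight κ = m} : ℤ)

/-! ### Symmetric functions; partitions are given by their Young diagrams -/

open Classical in
/-- The elementary symmetric function `e_k`: the sum of all squarefree monomials of degree `k`. -/
def elemSymm (k : ℕ) : MvPowerSeries ℕ ℤ :=
  fun m => if (∀ i, m i ≤ 1) ∧ m.support.card = k then 1 else 0

/-- `e_lam`, the product of the `e_k` over the parts `k` of `lam`. -/
def elemSymmPart (lam : YoungDiagram) : MvPowerSeries ℕ ℤ :=
  (lam.rowLens.map elemSymm).prod

open Classical in
/-- The monomial symmetric function `m_lam`: the sum of all monomials whose nonzero exponents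
are, as a multiset, the parts of `lam`. -/
def monoSymm (lam : YoungDiagram) : MvPowerSeries ℕ ℤ :=
  fun m => if m.support.val.map m = (lam.rowLens : Multiset ℕ) then 1 else 0

/-- `a` is a family of coefficients of an `e`-expansion of `f`, that is
`f = ∑ lam, a lam * e_lam`, a finite sum over partitions of arbitrary size. -/
def IsElemExpansion (f : MvPowerSeries ℕ ℤ) (a : YoungDiagram →₀ ℤ) : Prop :=
  f = a.sum fun lam z => z • elemSymmPart lam

/-! ### Cylindric `P`-tableaux -/

/-- The boxes `(row, column)`, counted from `0`, of the skew shape `lam / mu`. -/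
abbrev SkewCell (lam mu : YoungDiagram) : Type := ↥(lam.cells \ mu.cells)

/-- A filling of `lam / mu` is a `P`-tableau if it increases down columns and never
decreases from a box to the next one in its row. -/
def IsPTableau {P : Type*} [PartialOrder P] {lam mu : YoungDiagram}
    (T : SkewCell lam mu → P) : Prop :=
  (∀ (i j : ℕ) (h : (i, j) ∈ lam.cells \ mu.cells) (h' : (i + 1, j) ∈ lam.cells \ mu.cells),
    T ⟨(i, j), h⟩ < T ⟨(i + 1, j), h'⟩) ∧
  (∀ (i j : ℕ) (h : (i, j) ∈ lam.cells \ mu.cells) (h' : (i, j + 1) ∈ lam.cells \ mu.cells),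
    ¬ T ⟨(i, j + 1), h'⟩ < T ⟨(i, j), h⟩)

/-- A cylindric shape `lam / mu / d`. The length of the first row of `lam` is `outer.rowLen 0`,
and the length of column `j` of a diagram, counted from `0`, is `colLen j`. -/
structure CylindricShape where
  outer : YoungDiagram
  inner : YoungDiagram
  shift : ℕ
  inner_le : inner ≤ outer
  outer_shift : outer.colLen 0 - outer.colLen (outer.rowLen 0 - 1) ≤ shift
  inner_shift : inner.colLen 0 - inner.colLen (outer.rowLen 0 - 1) ≤ shift
  shift_le : shift ≤ outer.colLen 0

/-- The partition whose column lengths are `(kap'_1 + d, …, kap'_l + d, kap'_1)`. -/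
def glueDiagram (kap : YoungDiagram) (l d : ℕ)
    (h : kap.colLen 0 - kap.colLen (l - 1) ≤ d) : YoungDiagram where
  cells := (Finset.range (kap.colLen 0 + d) ×ˢ Finset.range (l + 1)).filter
    fun x => x.1 < if x.2 < l then kap.colLen x.2 + d else kap.colLen 0
  isLowerSet := by
    rintro ⟨i, j⟩ ⟨i', j'⟩ hle hx
    obtain ⟨hi : i' ≤ i, hj : j' ≤ j⟩ := hle
    simp only [Finset.coe_filter, Finset.mem_product, Finset.mem_range, Set.mem_ofPred_eq] at hx ⊢
    obtain ⟨⟨h1, h2⟩, h3⟩ := hx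
    refine ⟨⟨by omega, by omega⟩, ?_⟩
    by_cases hl : j < l
    · have := kap.colLen_anti j' j hj
      rw [if_pos hl] at h3
      rw [if_pos (by omega)]
      omega
    · rw [if_neg hl] at h3
      split_ifs with hl'
      · have := kap.colLen_anti j' (l - 1) (by omega)
        omega
      · omega

theorem mem_glueDiagram {kap : YoungDiagram} {l d : ℕ}
    {h : kap.colLen 0 - kap.colLen (l - 1) ≤ d} {i j : ℕ} :
    (i, j) ∈ (glueDiagram kap l d h).cells ↔
      (j < l ∧ i < kap.colLen j + d) ∨ (j = l ∧ i < kap.colLen 0) := by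
  have := kap.colLen_anti 0 j (Nat.zero_le _)
  simp only [glueDiagram, Finset.mem_filter, Finset.mem_product, Finset.mem_range]
  split_ifs with hl <;> omega

/-- The outer diagram of the shape of `T^d`. -/
def CylindricShape.gluedOuter (S : CylindricShape) : YoungDiagram :=
  glueDiagram S.outer (S.outer.rowLen 0) S.shift S.outer_shift

/-- The inner diagram of the shape of `T^d`. -/
def CylindricShape.gluedInner (S : CylindricShape) : YoungDiagram :=
  glueDiagram S.inner (S.outer.rowLen 0) S.shift S.inner_shift

/-- The box of `lam / mu` whose entry is copied into a given box of the shape of `T^d`: the old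
columns have moved down by `d` rows, and the added last column is a copy of the first one. -/
def CylindricShape.unglue (S : CylindricShape) (x : SkewCell S.gluedOuter S.gluedInner) :
    SkewCell S.outer S.inner :=
  ⟨if x.1.2 < S.outer.rowLen 0 then (x.1.1 - S.shift, x.1.2) else (x.1.1, 0), by
    obtain ⟨⟨i, j⟩, hx⟩ := x
    rw [Finset.mem_sdiff, CylindricShape.gluedOuter, CylindricShape.gluedInner,
      mem_glueDiagram, mem_glueDiagram] at hx
    dsimp only
    split_ifs with hl
    · rw [Finset.mem_sdiff, YoungDiagram.mem_cells, YoungDiagram.mem_cells,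
        YoungDiagram.mem_iff_lt_colLen, YoungDiagram.mem_iff_lt_colLen]
      omega
    · rw [Finset.mem_sdiff, YoungDiagram.mem_cells, YoungDiagram.mem_cells,
        YoungDiagram.mem_iff_lt_colLen, YoungDiagram.mem_iff_lt_colLen]
      omega⟩

/-- The filling `T^d`: a copy of the first column of `T` is glued to the last column of `T`,
shifted up by `d` boxes. -/
def CylindricShape.glue {P : Type*} (S : CylindricShape) (T : SkewCell S.outer S.inner → P) :
    SkewCell S.gluedOuter S.gluedInner → P :=
  fun x => T (S.unglue x)

/-- `T` is a cylindric `P`-tableau if `T^d` is a `P`-tableau. -/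
def IsCylindricPTableau {P : Type*} [PartialOrder P] (S : CylindricShape)
    (T : SkewCell S.outer S.inner → P) : Prop :=
  IsPTableau (S.glue T)

/-- The standard cylindric `P`-tableaux: those that contain each element of `P` exactly once. -/
def StandardCylindricPTableau (P : Type*) [PartialOrder P] (S : CylindricShape) : Type _ :=
  {T : SkewCell S.outer S.inner → P // IsCylindricPTableau S T ∧ ∀ p, ∃! b, T b = p}

/-- The cylindric Schur function: the generating function of the cylindric semistandard Young
tableaux, that is, of the cylindric `P`-tableaux for the total order `P = ℕ`. -/
def cylindricSchur (S : CylindricShape) : MvPowerSeries ℕ ℤ :=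
  fun m => (Nat.card
    {T : SkewCell S.outer S.inner → ℕ // IsCylindricPTableau S T ∧ weight T = m} : ℤ)

/-! ### Rectangles -/

/-- The partition `(r^c)`, with `c` rows of length `r`. -/
def rect (r c : ℕ) : YoungDiagram where
  cells := Finset.range c ×ˢ Finset.range r
  isLowerSet := by
    rintro ⟨i, j⟩ ⟨i', j'⟩ hle hx
    obtain ⟨hi : i' ≤ i, hj : j' ≤ j⟩ := hle
    simp only [Finset.mem_coe, Finset.mem_product, Finset.mem_range] at hx ⊢
    omega

theorem mem_rect {r c i j : ℕ} : (i, j) ∈ rect r c ↔ i < c ∧ j < r := by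
  rw [← YoungDiagram.mem_cells]
  simp [rect]

theorem rect_shift (r c : ℕ) :
    (rect r c).colLen 0 - (rect r c).colLen ((rect r c).rowLen 0 - 1) ≤ 0 := by
  rw [Nat.sub_eq_zero_of_le]
  by_contra! hlt
  have h0 := YoungDiagram.mem_iff_lt_colLen.mpr hlt
  have h1 := mem_rect.mp h0
  have h2 : ((rect r c).colLen ((rect r c).rowLen 0 - 1), (rect r c).rowLen 0 - 1)
      ∉ rect r c := by
    rw [YoungDiagram.mem_iff_lt_colLen]
    exact lt_irrefl _
  have h3 : (0, (rect r c).rowLen 0 - 1) ∈ rect r c := by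
    have h4 : (0, 0) ∈ rect r c := mem_rect.mpr (by omega)
    rw [YoungDiagram.mem_iff_lt_rowLen] at h4 ⊢
    omega
  rw [mem_rect] at h2 h3
  omega

/-- The cylindric shape `(r^c) / ∅ / 0`. -/
def rectShape (r c : ℕ) : CylindricShape where
  outer := rect r c
  inner := ⊥
  shift := 0
  inner_le := bot_le
  outer_shift := rect_shift r c
  inner_shift := by
    have h : (⊥ : YoungDiagram).colLen 0 = 0 := by
      by_contra hne
      exact YoungDiagram.notMem_bot _
        (YoungDiagram.mem_iff_lt_colLen.mpr (Nat.pos_of_ne_zero hne))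
    rw [h, Nat.zero_sub]
  shift_le := Nat.zero_le _

end CylPTab

end

/-!
Evaluate at the `r`-th roots of unity. There every `e_k` with `0 < k ≠ r` vanishes, so the
`e`-expansion of the chromatic symmetric function, which is homogeneous of degree `|P|`, collapses
to its term at `(r^c)` when `|P| = r c`; for other sizes of `P` both sides are `0`.

A colour class of a proper colouring is a chain, so a colouring by `ZMod r` cuts `P` into cyclically
arranged columns. Summing over the permutations of the roots of unity with signs turns the sum over
colourings into a sum of Jacobi-Trudi type determinants in the column lengths. These change sign
when the elements greater than the first violation `u` of the row condition are exchanged between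
the column of `u` and the preceding one, and the colouring stays proper because `P` is
`(3+1)`-free. The colourings left by this sign-reversing involution satisfy the cyclic row
condition; hence each of their columns is at most as long as the preceding one, all have length `c`,
and they are the standard cylindric tableaux.

For entries in a total order the cyclic row condition makes every row constant, so a cylindric
tableau of shape `(r^c)` amounts to `c` distinct numbers, each used `r` times.
-/

noncomputable section

namespace CylPTab

open scoped Classical Finset

section Colorings

variable {P C : Type*} [PartialOrder P]

theorem le_or_ge_of_color_eq (κ : (incGraph P).Coloring C) {v w : P} (h : κ v = κ w) :
    v ≤ w ∨ w ≤ v := by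
  by_contra! hvw
  exact κ.valid (show (incGraph P).Adj v w from hvw) h

variable [Fintype P]

/-- The length of the column of colour `c`: a colour class of a proper colouring of the
incomparability graph is a chain, which we regard as a column increasing downwards. -/
def colSize (κ : P → C) (c : C) : ℕ := #{v | κ v = c}

/-- The row of `u`, that is its position, counted from `0`, in its column. -/
def row (κ : P → C) (u : P) : ℕ := #{v | κ v = κ u ∧ v < u}

/-- The elements of column `c` that are not greater than `u`. They form an initial segment of that
column. -/
def notAbove (κ : P → C) (c : C) (u : P) : Finset P := {v | κ v = c ∧ ¬ u < v}

theorem mem_notAbove {κ : P → C} {c : C} {u v : P} : v ∈ notAbove κ c u ↔ κ v = c ∧ ¬ u < v := by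
  simp [notAbove]

theorem card_notAbove_le_colSize (κ : P → C) (c : C) (u : P) :
    #(notAbove κ c u) ≤ colSize κ c :=
  Finset.card_le_card fun _ hv => by simpa using (mem_notAbove.mp hv).1

theorem row_lt_row {κ : P → C} {v w : P} (h : κ v = κ w) (hlt : v < w) : row κ v < row κ w := by
  refine Finset.card_lt_card ((Finset.ssubset_iff_of_subset fun x => ?_).mpr ⟨v, ?_, ?_⟩)
  · simp only [Finset.mem_filter_univ]
    exact fun ⟨hx, hxv⟩ => ⟨hx.trans h, hxv.trans hlt⟩
  · simpa using ⟨h, hlt⟩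
  · simp

theorem lt_of_row_lt_row (κ : (incGraph P).Coloring C) {v w : P} (h : κ v = κ w)
    (hlt : row κ v < row κ w) : v < w := by
  rcases le_or_ge_of_color_eq κ h with hle | hle
  · exact hle.lt_of_ne fun hvw => by simp [hvw] at hlt
  · rcases hle.eq_or_lt with rfl | hwv
    · exact absurd hlt (lt_irrefl _)
    · exact absurd (row_lt_row h.symm hwv) hlt.not_gt

theorem eq_of_row_eq (κ : (incGraph P).Coloring C) {v w : P} (h : κ v = κ w)
    (hrow : row κ v = row κ w) : v = w := by
  by_contra hne
  rcases le_or_ge_of_color_eq κ h with hle | hle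
  · exact (row_lt_row h (hle.lt_of_ne hne)).ne hrow
  · exact (row_lt_row h.symm (hle.lt_of_ne' hne)).ne' hrow

theorem row_lt_colSize (κ : P → C) (u : P) : row κ u < colSize κ (κ u) := by
  refine Finset.card_lt_card ((Finset.ssubset_iff_of_subset fun x => ?_).mpr ⟨u, ?_, ?_⟩)
  · simp only [Finset.mem_filter_univ]
    exact And.left
  · simp
  · simp

theorem exists_row_eq (κ : (incGraph P).Coloring C) {c : C} {m : ℕ} (hm : m < colSize κ c) :
    ∃ v, κ v = c ∧ row κ v = m := by
  have himage : Finset.image (row κ) {v | κ v = c} = Finset.range (colSize κ c) := by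
    refine Finset.eq_of_subset_of_card_le (Finset.image_subset_iff.mpr fun v hv => ?_) ?_
    · obtain rfl : κ v = c := by simpa using hv
      exact Finset.mem_range.mpr (row_lt_colSize κ v)
    · rw [Finset.card_image_of_injOn, Finset.card_range, colSize]
      intro v hv w hw hvw
      simp only [Finset.coe_filter, Finset.mem_univ, true_and, Set.mem_ofPred_eq] at hv hw
      exact eq_of_row_eq κ (hv.trans hw.symm) hvw
  simpa using himage.ge (Finset.mem_range.mpr hm)

theorem card_notAbove_self (κ : (incGraph P).Coloring C) (u : P) :
    #(notAbove κ (κ u) u) = row κ u + 1 := by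
  rw [row, ← Finset.card_insert_of_notMem (a := u) (by simp)]
  congr 1
  ext v
  simp only [mem_notAbove, Finset.mem_insert, Finset.mem_filter_univ]
  constructor
  · rintro ⟨hv, huv⟩
    rcases le_or_ge_of_color_eq κ hv with hle | hle
    · exact hle.eq_or_lt.imp_right fun hlt => ⟨hv, hlt⟩
    · exact Or.inl (hle.eq_of_not_lt huv).symm
  · rintro (rfl | ⟨hv, hlt⟩)
    · exact ⟨rfl, lt_irrefl _⟩
    · exact ⟨hv, hlt.not_gt⟩

theorem notAbove_subset_notAbove (κ : P → C) (c : C) {u w : P} (h : w ≤ u) :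
    notAbove κ c w ⊆ notAbove κ c u := fun _ hv =>
  mem_notAbove.mpr ((mem_notAbove.mp hv).imp_right fun hwv huv => hwv (h.trans_lt huv))

/-- The entry to the left of `u`, in the column of colour `prev (κ u)` and in the row of `u`, is
missing or greater than `u`. -/
def IsFlaw (prev : C → C) (κ : P → C) (u : P) : Prop :=
  #(notAbove κ (prev (κ u)) u) ≤ row κ u

theorem not_isFlaw_iff (prev : C → C) (κ : (incGraph P).Coloring C) {u : P} :
    ¬ IsFlaw prev κ u ↔ ∃ v, κ v = prev (κ u) ∧ row κ v = row κ u ∧ ¬ u < v := by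
  rw [IsFlaw, not_le]
  constructor
  · intro h
    obtain ⟨v, hv, hrow⟩ := exists_row_eq κ (h.trans_le (card_notAbove_le_colSize _ _ _))
    refine ⟨v, hv, hrow, fun huv => h.not_ge ?_⟩
    rw [← hrow]
    refine Finset.card_le_card fun x hx => ?_
    obtain ⟨hx, hux⟩ := mem_notAbove.mp hx
    rcases le_or_ge_of_color_eq κ (hx.trans hv.symm) with hle | hle
    · simpa using ⟨hx.trans hv.symm, hle.lt_of_ne fun hxv => hux (hxv ▸ huv)⟩
    · exact absurd (huv.trans_le hle) hux
  · rintro ⟨v, hv, hrow, huv⟩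
    rw [← hrow, ← Nat.succ_le_iff, Nat.succ_eq_add_one, ← card_notAbove_self]
    refine Finset.card_le_card fun x hx => ?_
    obtain ⟨hx, hvx⟩ := mem_notAbove.mp hx
    refine mem_notAbove.mpr ⟨hx.trans hv, fun hux => ?_⟩
    rcases le_or_ge_of_color_eq κ hx with hle | hle
    · exact huv (hux.trans_le hle)
    · exact huv (hle.eq_of_not_lt hvx ▸ hux)

theorem card_notAbove_le_row (κ : (incGraph P).Coloring C) {u w : P} (huw : u < w) :
    #(notAbove κ (κ w) u) ≤ row κ w := by
  refine Finset.card_le_card fun v hv => ?_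
  obtain ⟨hvw, huv⟩ := mem_notAbove.mp hv
  rcases le_or_ge_of_color_eq κ hvw with hle | hle
  · simpa using ⟨hvw, hle.lt_of_ne fun h => huv (h ▸ huw)⟩
  · exact absurd (huw.trans_le hle) huv

theorem IsFlaw.row_lt_row_of_prev_eq {prev : C → C} {κ : (incGraph P).Coloring C} {u w : P}
    (hw : IsFlaw prev κ w) (hprev : prev (κ w) = κ u) (hwu : ¬ w ≤ u) : row κ u < row κ w := by
  rw [← Nat.succ_le_iff, Nat.succ_eq_add_one, ← card_notAbove_self, ← hprev]
  refine (Finset.card_le_card fun v hv => ?_).trans hw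
  obtain ⟨hv, huv⟩ := mem_notAbove.mp hv
  refine mem_notAbove.mpr ⟨hv, fun hwv => ?_⟩
  rcases le_or_ge_of_color_eq κ (hv.trans hprev) with hle | hle
  · exact hwu (hwv.le.trans hle)
  · exact hwu (hle.eq_of_not_lt huv ▸ hwv.le)

end Colorings

section FirstFlaws

variable {P C : Type*} [PartialOrder P] [Fintype P] {prev : C → C}

/-- `u` is the first flaw of `κ`, reading row by row and each row along a fixed linear extension
of `P`. -/
def IsFirstFlaw (prev : C → C) (κ : P → C) (u : P) : Prop :=
  IsFlaw prev κ u ∧ ∀ w, IsFlaw prev κ w →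
    row κ u < row κ w ∨ row κ u = row κ w ∧ toLinearExtension u ≤ toLinearExtension w

theorem exists_isFirstFlaw {κ : P → C} (h : ∃ u, IsFlaw prev κ u) :
    ∃ u, IsFirstFlaw prev κ u := by
  obtain ⟨u, hu, hmin⟩ := Set.exists_min_image {u | IsFlaw prev κ u}
    (fun u => toLex (row κ u, toLinearExtension u)) (Set.toFinite _) h
  exact ⟨u, hu, fun w hw => (Prod.Lex.le_iff ..).mp (hmin w hw)⟩

theorem IsFirstFlaw.unique {κ : P → C} {u w : P} (hu : IsFirstFlaw prev κ u)
    (hw : IsFirstFlaw prev κ w) : u = w := by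
  have huw := hu.2 w hw.1
  have hwu := hw.2 u hu.1
  have hle : toLinearExtension u ≤ toLinearExtension w := by lia
  have hge : toLinearExtension w ≤ toLinearExtension u := by lia
  exact hle.antisymm hge

theorem IsFlaw.prev_ne {κ : (incGraph P).Coloring C} {u : P} (hu : IsFlaw prev κ u) :
    prev (κ u) ≠ κ u := by
  intro h
  rw [IsFlaw, h, card_notAbove_self] at hu
  exact absurd hu (Nat.not_succ_le_self _)

/-- The predecessor of `u` in its column is not a flaw. -/
theorem IsFirstFlaw.exists_pred {κ : (incGraph P).Coloring C} {u : P}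
    (hu : IsFirstFlaw prev κ u) (hrow : row κ u ≠ 0) :
    ∃ w < u, notAbove κ (prev (κ u)) w ⊆ notAbove κ (prev (κ u)) u ∧
      row κ u ≤ #(notAbove κ (prev (κ u)) w) := by
  obtain ⟨w, hw, hrow_w⟩ := exists_row_eq κ (c := κ u) (m := row κ u - 1)
    (by have := row_lt_colSize κ u; lia)
  have hwu : w < u := lt_of_row_lt_row κ hw (by lia)
  have hflaw : ¬ IsFlaw prev κ w := fun h => by have := hu.2 w h; lia
  rw [IsFlaw, not_le, hw] at hflaw
  exact ⟨w, hwu, notAbove_subset_notAbove _ _ hwu.le, by lia⟩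

theorem IsFirstFlaw.card_notAbove_prev {κ : (incGraph P).Coloring C} {u : P}
    (hu : IsFirstFlaw prev κ u) : #(notAbove κ (prev (κ u)) u) = row κ u := by
  refine hu.1.antisymm ?_
  rcases eq_or_ne (row κ u) 0 with hrow | hrow
  · exact hrow ▸ Nat.zero_le _
  · obtain ⟨w, -, hsub, hcard⟩ := hu.exists_pred hrow
    exact hcard.trans (Finset.card_le_card hsub)

theorem IsFirstFlaw.exists_lt_notAbove_eq {κ : (incGraph P).Coloring C} {u : P}
    (hu : IsFirstFlaw prev κ u) (hne : (notAbove κ (prev (κ u)) u).Nonempty) :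
    ∃ w < u, notAbove κ (prev (κ u)) w = notAbove κ (prev (κ u)) u := by
  have hcard := hu.card_notAbove_prev
  obtain ⟨w, hwu, hsub, hle⟩ := hu.exists_pred (hcard ▸ hne.card_pos.ne')
  exact ⟨w, hwu, Finset.eq_of_subset_of_card_le hsub (hcard.trans_le hle)⟩

end FirstFlaws

section Switching

variable {P C : Type*} [PartialOrder P] {prev : C → C}

/-- Exchange the elements greater than `u` between the column of `u` and the column preceding it. -/
def switchAbove (prev : C → C) (κ : P → C) (u v : P) : C :=
  if u < v then Equiv.swap (prev (κ u)) (κ u) (κ v) else κ v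

theorem switchAbove_of_lt (κ : P → C) {u v : P} (h : u < v) :
    switchAbove prev κ u v = Equiv.swap (prev (κ u)) (κ u) (κ v) := if_pos h

theorem switchAbove_of_not_lt (κ : P → C) {u v : P} (h : ¬ u < v) :
    switchAbove prev κ u v = κ v := if_neg h

theorem switchAbove_self (κ : P → C) (u : P) : switchAbove prev κ u u = κ u :=
  switchAbove_of_not_lt κ (lt_irrefl u)

theorem switchAbove_switchAbove (κ : P → C) (u : P) :
    switchAbove prev (switchAbove prev κ u) u = κ := by
  funext v
  by_cases h : u < v
  · rw [switchAbove_of_lt _ h, switchAbove_self, switchAbove_of_lt κ h, Equiv.swap_apply_self]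
  · rw [switchAbove_of_not_lt _ h, switchAbove_of_not_lt κ h]

theorem switchAbove_eq_iff (κ : P → C) {u v : P} {c : C} (hc : c ≠ κ u)
    (hc' : u < v → c ≠ prev (κ u)) : switchAbove prev κ u v = c ↔ κ v = c := by
  by_cases huv : u < v
  · rw [switchAbove_of_lt κ huv, Equiv.swap_apply_eq_iff,
      Equiv.swap_apply_of_ne_of_ne (hc' huv) hc]
  · rw [switchAbove_of_not_lt κ huv]

variable [Fintype P]

theorem row_switchAbove (κ : P → C) {u w : P} (h : ¬ u < w) :
    row (switchAbove prev κ u) w = row κ w := by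
  refine congrArg Finset.card (Finset.filter_congr fun v _ => and_congr_left fun hvw => ?_)
  rw [switchAbove_of_not_lt κ h, switchAbove_of_not_lt κ fun huv => h (huv.trans hvw)]

theorem notAbove_switchAbove (κ : P → C) (c : C) {u w : P} (h : w ≤ u) :
    notAbove (switchAbove prev κ u) c w = notAbove κ c w := by
  ext v
  simp only [mem_notAbove]
  exact and_congr_left fun hwv => by
    rw [switchAbove_of_not_lt κ fun huv => hwv (h.trans_lt huv)]

theorem isFlaw_switchAbove_iff (κ : P → C) {u w : P} (h : w ≤ u) :
    IsFlaw prev (switchAbove prev κ u) w ↔ IsFlaw prev κ w := by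
  rw [IsFlaw, notAbove_switchAbove κ _ h, row_switchAbove κ h.not_gt,
    switchAbove_of_not_lt κ h.not_gt, IsFlaw]

theorem colSize_switchAbove (κ : P → C) (u : P) (c : C) :
    colSize (switchAbove prev κ u) c + #(notAbove κ (Equiv.swap (prev (κ u)) (κ u) c) u) =
      #(notAbove κ c u) + colSize κ (Equiv.swap (prev (κ u)) (κ u) c) := by
  have hsplit : ∀ (f : P → C) (d : C),
      colSize f d = #(notAbove f d u) + #{v | f v = d ∧ u < v} := fun f d => by
    rw [colSize, notAbove, add_comm,
      ← Finset.card_filter_add_card_filter_not (s := {v | f v = d}) (u < ·),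
      Finset.filter_filter, Finset.filter_filter]
  have habove : #{v | switchAbove prev κ u v = c ∧ u < v} =
      #{v | κ v = Equiv.swap (prev (κ u)) (κ u) c ∧ u < v} := by
    refine congrArg Finset.card (Finset.filter_congr fun v _ => and_congr_left fun huv => ?_)
    rw [switchAbove_of_lt κ huv, Equiv.swap_apply_eq_iff]
  rw [hsplit, hsplit κ, habove, notAbove_switchAbove κ c le_rfl]
  ring

theorem IsFirstFlaw.swap_color_ne (hP : ThreePlusOneFree P) {κ : (incGraph P).Coloring C} {u : P}
    (hu : IsFirstFlaw prev κ u) {x y : P} (hxy : (incGraph P).Adj x y) (hux : u < x)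
    (huy : ¬ u < y) : Equiv.swap (prev (κ u)) (κ u) (κ x) ≠ κ y := by
  have hyx : ¬ y ≤ x := hxy.2
  rcases eq_or_ne (κ x) (κ u) with hx | hx
  · rw [hx, Equiv.swap_apply_right]
    intro hy
    obtain ⟨w, hwu, hw⟩ := hu.exists_lt_notAbove_eq ⟨y, mem_notAbove.mpr ⟨hy.symm, huy⟩⟩
    have hwy : ¬ w < y :=
      (mem_notAbove.mp (hw ▸ mem_notAbove.mpr ⟨hy.symm, huy⟩ : y ∈ notAbove κ _ w)).2
    have hincomp : ∀ z < x, ¬ z < y → IncompRel (· ≤ ·) z y := fun z hzx hzy =>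
      ⟨fun hle => hyx (hle.eq_of_not_lt hzy ▸ hzx.le), fun hle => hyx (hle.trans hzx.le)⟩
    exact hP w u x y hwu hux ⟨hincomp w (hwu.trans hux) hwy, hincomp u hux huy, hxy⟩
  · rcases eq_or_ne (κ x) (prev (κ u)) with hx' | hx'
    · rw [hx', Equiv.swap_apply_left]
      intro hy
      rcases le_or_ge_of_color_eq κ hy with hle | hle
      · exact hyx (hle.eq_of_not_lt huy ▸ hux.le)
      · exact hyx (hle.trans hux.le)
    · rw [Equiv.swap_apply_of_ne_of_ne hx' hx]
      exact κ.valid hxy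

theorem IsFirstFlaw.switchAbove_ne (hP : ThreePlusOneFree P) {κ : (incGraph P).Coloring C}
    {u : P} (hu : IsFirstFlaw prev κ u) {x y : P} (hxy : (incGraph P).Adj x y) :
    switchAbove prev κ u x ≠ switchAbove prev κ u y := by
  by_cases hux : u < x <;> by_cases huy : u < y
  · rw [switchAbove_of_lt κ hux, switchAbove_of_lt κ huy]
    exact (Equiv.injective _).ne (κ.valid hxy)
  · rw [switchAbove_of_lt κ hux, switchAbove_of_not_lt κ huy]
    exact hu.swap_color_ne hP hxy hux huy
  · rw [switchAbove_of_not_lt κ hux, switchAbove_of_lt κ huy]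
    exact (hu.swap_color_ne hP hxy.symm huy hux).symm
  · rw [switchAbove_of_not_lt κ hux, switchAbove_of_not_lt κ huy]
    exact κ.valid hxy

theorem isFlaw_and_row_eq_of_isFlaw_switchAbove (hprev : Function.Injective prev) {κ : P → C}
    {u w : P} (hw : IsFlaw prev (switchAbove prev κ u) w) (hne : switchAbove prev κ u w ≠ κ u)
    (hne' : u < w → switchAbove prev κ u w ≠ prev (κ u))
    (hprev_ne : prev (switchAbove prev κ u w) ≠ κ u) :
    IsFlaw prev κ w ∧ row (switchAbove prev κ u) w = row κ w := by
  have hcolor : κ w = switchAbove prev κ u w := (switchAbove_eq_iff κ hne hne').mp rfl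
  have hleft : notAbove (switchAbove prev κ u) (prev (κ w)) w = notAbove κ (prev (κ w)) w := by
    ext v
    rw [mem_notAbove, mem_notAbove, switchAbove_eq_iff κ (hcolor ▸ hprev_ne)
      fun _ h => hne (hcolor ▸ hprev h)]
  have hrow : row (switchAbove prev κ u) w = row κ w := by
    refine congrArg Finset.card (Finset.filter_congr fun v _ => and_congr_left fun hvw => ?_)
    rw [← hcolor, switchAbove_eq_iff κ (hcolor ▸ hne) fun huv => hcolor ▸ hne' (huv.trans hvw)]
  rw [IsFlaw, ← hcolor, hleft, hrow] at hw
  exact ⟨hw, hrow⟩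

theorem IsFirstFlaw.of_eq_switchAbove (hprev : Function.Injective prev)
    {κ κ' : (incGraph P).Coloring C} {u : P} (hu : IsFirstFlaw prev κ u)
    (hκ' : ⇑κ' = switchAbove prev κ u) :
    IsFirstFlaw prev κ' u := by
  have hcolor : κ' u = κ u := by rw [hκ', switchAbove_self]
  have hrow : row κ' u = row κ u := by rw [hκ', row_switchAbove κ (lt_irrefl u)]
  have hflaw : IsFlaw prev κ' u := by rw [hκ', isFlaw_switchAbove_iff κ le_rfl]; exact hu.1
  refine ⟨hflaw, fun w hw => ?_⟩
  by_cases hwu : w ≤ u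
  · rw [hκ', isFlaw_switchAbove_iff κ hwu] at hw
    rw [hκ', row_switchAbove κ (lt_irrefl u), row_switchAbove κ hwu.not_gt]
    exact hu.2 w hw
  -- A new flaw has to lie below `u` in its column, to the right of it, or below the place where
  -- the column preceding `u` was cut.
  by_cases hsame : κ' w = κ' u
  · have huw : u < w := (lt_of_le_not_ge · hwu)
      ((le_or_ge_of_color_eq κ' hsame).resolve_left hwu)
    exact Or.inl (row_lt_row hsame.symm huw)
  by_cases hright : prev (κ' w) = κ' u
  · exact Or.inl (hw.row_lt_row_of_prev_eq hright hwu)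
  by_cases hleft : u < w ∧ κ' w = prev (κ' u)
  · obtain ⟨huw, hw_left⟩ := hleft
    have hle : row κ' u ≤ row κ' w := by
      rw [hrow, ← hu.card_notAbove_prev, ← notAbove_switchAbove (prev := prev) κ _ le_rfl, ← hκ',
        ← hcolor, ← hw_left]
      exact card_notAbove_le_row κ' huw
    exact hle.lt_or_eq.imp_right fun h => ⟨h, toLinearExtension.monotone huw.le⟩
  · rw [hκ'] at hw
    rw [hcolor, hκ'] at hsame hright hleft
    obtain ⟨hflaw_w, hrow_w⟩ := isFlaw_and_row_eq_of_isFlaw_switchAbove hprev hw hsame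
      (fun huw h => hleft ⟨huw, h⟩) hright
    rw [hrow, hκ', hrow_w]
    exact hu.2 w hflaw_w

end Switching

section Alternating

variable {P C : Type*} [PartialOrder P] [Fintype P] {prev : C → C} {A : Type*} [AddCommGroup A]

/-- A function of column lengths is alternating if it changes sign whenever the lengths `a`, `b` of
a column's predecessor and of the column itself become `b - 1`, `a + 1`, as they do under a
switch above a first flaw. -/
def IsAlternating (prev : C → C) (W : (C → ℕ) → A) : Prop :=
  ∀ (k k' : C → ℕ) (c : C), prev c ≠ c → k' (prev c) + 1 = k c → k' c = k (prev c) + 1 →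
    (∀ d, d ≠ prev c → d ≠ c → k' d = k d) → W k' = - W k

theorem IsFirstFlaw.apply_colSize_switchAbove {κ : (incGraph P).Coloring C} {u : P}
    (hu : IsFirstFlaw prev κ u) {W : (C → ℕ) → A} (hW : IsAlternating prev W) :
    W (colSize (switchAbove prev κ u)) = - W (colSize κ) := by
  have hleft := colSize_switchAbove (prev := prev) κ u (prev (κ u))
  have hown := colSize_switchAbove (prev := prev) κ u (κ u)
  rw [Equiv.swap_apply_left, card_notAbove_self, hu.card_notAbove_prev] at hleft
  rw [Equiv.swap_apply_right, card_notAbove_self, hu.card_notAbove_prev] at hown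
  refine hW _ _ (κ u) hu.1.prev_ne (by lia) (by lia) fun d hd hd' => ?_
  have hother := colSize_switchAbove (prev := prev) κ u d
  rw [Equiv.swap_apply_of_ne_of_ne hd hd'] at hother
  lia

variable [Fintype C]

variable (P) in
/-- The proper colourings all of whose entries have an entry to their left that is not greater. -/
def flawlessColorings (prev : C → C) : Finset ((incGraph P).Coloring C) :=
  {κ | ∀ u : P, ¬ IsFlaw prev κ u}

theorem mem_flawlessColorings {κ : (incGraph P).Coloring C} :
    κ ∈ flawlessColorings P prev ↔ ∀ u, ¬ IsFlaw prev κ u := by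
  simp [flawlessColorings]

theorem exists_isFirstFlaw_of_mem_compl {κ : (incGraph P).Coloring C}
    (hκ : κ ∈ (flawlessColorings P prev)ᶜ) : ∃ u, IsFirstFlaw prev κ u :=
  exists_isFirstFlaw (by simpa [mem_flawlessColorings] using hκ)

theorem sum_alternating_colSize [IsAddTorsionFree A] (hP : ThreePlusOneFree P)
    (hprev : Function.Injective prev) {W : (C → ℕ) → A} (hW : IsAlternating prev W) :
    ∑ κ : (incGraph P).Coloring C, W (colSize κ) =
      ∑ κ ∈ flawlessColorings P prev, W (colSize κ) := by
  suffices hflawed : ∑ κ ∈ (flawlessColorings P prev)ᶜ, W (colSize κ) = 0 by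
    rw [← Finset.sum_add_sum_compl (flawlessColorings P prev), hflawed, add_zero]
  choose first hfirst using fun κ : (incGraph P).Coloring C =>
    exists_isFirstFlaw_of_mem_compl (prev := prev) (κ := κ)
  let switch (κ : (incGraph P).Coloring C) hκ : (incGraph P).Coloring C :=
    SimpleGraph.Coloring.mk (switchAbove prev κ (first κ hκ)) ((hfirst κ hκ).switchAbove_ne hP)
  have hswitch : ∀ κ hκ, IsFirstFlaw prev (switch κ hκ) (first κ hκ) := fun κ hκ =>
    (hfirst κ hκ).of_eq_switchAbove hprev rfl
  have hmem : ∀ κ hκ, switch κ hκ ∈ (flawlessColorings P prev)ᶜ := fun κ hκ => by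
    rw [Finset.mem_compl, mem_flawlessColorings]
    exact fun h => h _ (hswitch κ hκ).1
  have hneg : ∀ κ hκ, W (colSize (switch κ hκ)) = - W (colSize κ) := fun κ hκ =>
    (hfirst κ hκ).apply_colSize_switchAbove hW
  refine Finset.sum_involution switch (fun κ hκ => ?_) (fun κ hκ hne heq => ?_) hmem
    fun κ hκ => ?_
  · rw [hneg, add_neg_cancel]
  · exact hne (self_eq_neg.mp (by rw [← hneg κ hκ, heq]))
  · have hsame : first (switch κ hκ) (hmem κ hκ) = first κ hκ :=
      (hfirst _ (hmem κ hκ)).unique (hswitch κ hκ)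
    refine DFunLike.coe_injective ?_
    change switchAbove prev (switchAbove prev κ (first κ hκ)) (first (switch κ hκ) _) = κ
    rw [hsame, switchAbove_switchAbove]

end Alternating

section CyclicColumns

variable {r : ℕ} [NeZero r]

theorem apply_le_apply_of_forall_add_one_le {α : Type*} [Preorder α] {f : ZMod r → α}
    (h : ∀ j, f (j + 1) ≤ f j) (j j' : ZMod r) : f j ≤ f j' := by
  have hadd : ∀ n : ℕ, f (j' + n) ≤ f j' := fun n => by
    induction n with
    | zero => simp
    | succ n ih => simpa [add_assoc] using (h (j' + n)).trans ih
  simpa using hadd (j - j').val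

variable {P : Type*} [Fintype P]

theorem sum_colSize {C : Type*} [Fintype C] (κ : P → C) : ∑ c, colSize κ c = Fintype.card P :=
  (Finset.card_eq_sum_card_fiberwise fun _ _ => Finset.mem_univ _).symm

variable [PartialOrder P]

theorem colSize_le_colSize_prev {C : Type*} {prev : C → C} {κ : (incGraph P).Coloring C}
    (hκ : ∀ u, ¬ IsFlaw prev κ u) (c : C) : colSize κ c ≤ colSize κ (prev c) := by
  refine le_of_forall_lt fun m hm => ?_
  obtain ⟨v, rfl, rfl⟩ := exists_row_eq κ hm
  obtain ⟨w, hw, hrow, -⟩ := (not_isFlaw_iff prev κ).mp (hκ v)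
  rw [← hrow, ← hw]
  exact row_lt_colSize κ w

theorem colSize_eq_of_flawless {c : ℕ} (hcard : Fintype.card P = r * c)
    {κ : (incGraph P).Coloring (ZMod r)} (hκ : ∀ u, ¬ IsFlaw (· - 1) κ u) (j : ZMod r) :
    colSize κ j = c := by
  have hle := apply_le_apply_of_forall_add_one_le (f := colSize κ) fun j => by
    simpa using colSize_le_colSize_prev hκ (j + 1)
  have hsum : r * colSize κ j = r * c := by
    rw [← hcard, ← sum_colSize κ, Finset.sum_congr rfl fun i _ => (hle i j).antisymm (hle j i)]
    simp
  exact Nat.eq_of_mul_eq_mul_left (NeZero.pos r) hsum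

end CyclicColumns

section ColoringSums

variable {V ι R : Type*} [Fintype V] [CommSemiring R]

theorem sum_coloring_comp_perm [Fintype ι] (G : SimpleGraph V) (σ : Equiv.Perm ι) (f : ι → R) :
    ∑ κ : G.Coloring ι, ∏ v, f (σ (κ v)) = ∑ κ : G.Coloring ι, ∏ v, f (κ v) :=
  (G.recolorOfEquiv σ).sum_comp fun κ => ∏ v, f (κ v)

theorem prod_comp_eq_prod_pow_colSize [Fintype ι] (κ : V → ι) (f : ι → R) :
    ∏ v, f (κ v) = ∏ i, f i ^ colSize κ i := by
  rw [← Finset.prod_fiberwise Finset.univ κ]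
  refine Finset.prod_congr rfl fun i _ => Finset.prod_eq_pow_card fun v hv => ?_
  rw [(Finset.mem_filter.mp hv).2]

end ColoringSums

section CharacterDeterminant

variable {r : ℕ} {K : Type*} [CommRing K]

/-- The matrix with entries `ψ i ^ (k j - j)`, where `ψ` identifies `ZMod r` with the `r`-th roots
of unity. Up to sign, its determinant is that of the Jacobi-Trudi formula evaluated at the roots of
unity. -/
def charMatrix (ψ : AddChar (ZMod r) K) (k : ZMod r → ℕ) : Matrix (ZMod r) (ZMod r) K :=
  .of fun i j => ψ (i * (k j - j))

theorem charMatrix_apply (ψ : AddChar (ZMod r) K) (k : ZMod r → ℕ) (i j : ZMod r) :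
    charMatrix ψ k i j = ψ i ^ k j * charMatrix ψ 0 i j := by
  simp only [charMatrix, Matrix.of_apply, Pi.zero_apply, Nat.cast_zero]
  rw [← ψ.map_nsmul_eq_pow, ← ψ.map_add_eq_mul, nsmul_eq_mul]
  congr 1; ring

variable [NeZero r]

theorem isAlternating_det_charMatrix (ψ : AddChar (ZMod r) K) :
    IsAlternating (· - 1) fun k => (charMatrix ψ k).det := by
  intro k k' j hne hprev hself hother
  have hswap : charMatrix ψ k' = (charMatrix ψ k).submatrix id (Equiv.swap (j - 1) j) := by
    have hprev' : (k' (j - 1) : ZMod r) + 1 = k j := mod_cast congrArg Nat.cast hprev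
    have hself' : (k' j : ZMod r) = k (j - 1) + 1 := mod_cast congrArg Nat.cast hself
    ext i l
    simp only [charMatrix, Matrix.of_apply, Matrix.submatrix_apply, id_eq]
    rcases eq_or_ne l (j - 1) with rfl | hl
    · rw [Equiv.swap_apply_left, ← hprev']
      congr 1; ring
    rcases eq_or_ne l j with rfl | hl'
    · rw [Equiv.swap_apply_right, hself']
      congr 1; ring
    · rw [Equiv.swap_apply_of_ne_of_ne hl hl', hother l hl hl']
  change (charMatrix ψ k').det = -(charMatrix ψ k).det
  rw [hswap, Matrix.det_permute', Equiv.Perm.sign_swap hne]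
  simp

theorem det_charMatrix_const (ψ : AddChar (ZMod r) K) (c : ℕ) :
    (charMatrix ψ fun _ => c).det = (∏ i, ψ i) ^ c * (charMatrix ψ 0).det := by
  rw [← Finset.prod_pow, ← Matrix.det_mul_column]
  congr 1
  ext i j
  exact charMatrix_apply ψ _ i j

theorem det_charMatrix_zero_ne_zero [IsDomain K] [CharZero K] {ψ : AddChar (ZMod r) K}
    (hψ : ψ.IsPrimitive) : (charMatrix ψ 0).det ≠ 0 := by
  have horth : charMatrix ψ 0 * .of (fun j l => ψ (j * l)) =
      (r : K) • (1 : Matrix (ZMod r) (ZMod r) K) := by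
    ext i l
    have hterm : ∀ j, ψ (i * (0 - j)) * ψ (j * l) = ψ (j * (l - i)) := fun j => by
      rw [← ψ.map_add_eq_mul]
      congr 1; ring
    simp only [charMatrix, Matrix.mul_apply, Matrix.of_apply, Pi.zero_apply, Nat.cast_zero, hterm,
      AddChar.sum_mulShift _ hψ, sub_eq_zero, ZMod.card, Matrix.smul_apply, Matrix.one_apply,
      smul_eq_mul, mul_ite, mul_one, mul_zero, eq_comm (a := l)]
    split_ifs <;> simp
  refine left_ne_zero_of_mul (b := (Matrix.of fun j l => ψ (j * l)).det) ?_
  rw [← Matrix.det_mul, horth, Matrix.det_smul, Matrix.det_one, mul_one]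
  exact pow_ne_zero _ (NeZero.ne (r : K))

theorem sum_coloring_mul_det_charMatrix_zero {V : Type*} [Fintype V] (G : SimpleGraph V)
    (ψ : AddChar (ZMod r) K) :
    (∑ κ : G.Coloring (ZMod r), ∏ v, ψ (κ v)) * (charMatrix ψ 0).det =
      ∑ κ : G.Coloring (ZMod r), (charMatrix ψ (colSize κ)).det := by
  simp only [Matrix.det_apply']
  rw [Finset.sum_comm, Finset.mul_sum]
  refine Finset.sum_congr rfl fun σ _ => ?_
  rw [← sum_coloring_comp_perm G σ, Finset.sum_mul]
  refine Finset.sum_congr rfl fun κ _ => ?_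
  simp only [charMatrix_apply ψ (colSize κ), Finset.prod_mul_distrib]
  rw [prod_comp_eq_prod_pow_colSize κ fun i => ψ (σ i)]
  ring

theorem sum_incGraph_coloring_addChar [IsDomain K] [CharZero K] {ψ : AddChar (ZMod r) K}
    (hψ : ψ.IsPrimitive) {P : Type*} [PartialOrder P] [Fintype P] (hP : ThreePlusOneFree P)
    {c : ℕ} (hcard : Fintype.card P = r * c) :
    ∑ κ : (incGraph P).Coloring (ZMod r), ∏ v, ψ (κ v) =
      #(flawlessColorings P (· - 1 : ZMod r → ZMod r)) * (∏ i, ψ i) ^ c := by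
  refine mul_right_cancel₀ (det_charMatrix_zero_ne_zero hψ) ?_
  rw [sum_coloring_mul_det_charMatrix_zero,
    sum_alternating_colSize hP sub_left_injective
      (isAlternating_det_charMatrix ψ), mul_assoc, ← det_charMatrix_const, ← nsmul_eq_mul]
  refine Finset.sum_eq_card_nsmul fun κ hκ => ?_
  rw [funext (colSize_eq_of_flawless hcard (mem_flawlessColorings.mp hκ))]

end CharacterDeterminant

section Rectangles

theorem mem_rectShape_cells {r c : ℕ} {x : ℕ × ℕ} :
    x ∈ (rectShape r c).outer.cells \ (rectShape r c).inner.cells ↔ x.1 < c ∧ x.2 < r := by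
  simp [rectShape, rect]

theorem colLen_rect {r c j : ℕ} (hj : j < r) : (rect r c).colLen j = c := by
  refine eq_of_forall_lt_iff fun i => ?_
  rw [← YoungDiagram.mem_iff_lt_colLen, mem_rect]
  exact and_iff_left hj

theorem rowLen_rect {r c i : ℕ} (hi : i < c) : (rect r c).rowLen i = r := by
  refine eq_of_forall_lt_iff fun j => ?_
  rw [← YoungDiagram.mem_iff_lt_rowLen, mem_rect]
  exact and_iff_right hi

theorem colLen_bot (j : ℕ) : (⊥ : YoungDiagram).colLen j = 0 := by
  refine eq_of_forall_lt_iff fun i => ?_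
  rw [← YoungDiagram.mem_iff_lt_colLen]
  simp

variable {r c : ℕ} [NeZero r]

variable (r c) in
/-- The boxes of a rectangle, with the columns indexed cyclically. -/
def rectCellEquiv :
    SkewCell (rectShape r c).outer (rectShape r c).inner ≃ Fin c × ZMod r where
  toFun x := (⟨x.1.1, (mem_rectShape_cells.mp x.2).1⟩, x.1.2)
  invFun y := ⟨(y.1, y.2.val), mem_rectShape_cells.mpr ⟨y.1.2, y.2.val_lt⟩⟩
  left_inv x := Subtype.ext (Prod.ext rfl (ZMod.val_cast_of_lt (mem_rectShape_cells.mp x.2).2))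
  right_inv y := Prod.ext rfl (ZMod.natCast_zmod_val y.2)

theorem mem_glued_rect {i j : ℕ} :
    (i, j) ∈ (rectShape r c).gluedOuter.cells \ (rectShape r c).gluedInner.cells ↔
      i < c ∧ j ≤ r := by
  have hfirst : (rect r c).colLen 0 = c := colLen_rect (NeZero.pos r)
  have hanti := (rect r c).colLen_anti 0 j (Nat.zero_le j)
  simp only [Finset.mem_sdiff, CylindricShape.gluedOuter, CylindricShape.gluedInner,
    mem_glueDiagram, rectShape, colLen_bot, add_zero, not_lt_zero, and_false, or_self,
    not_false_eq_true, and_true]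
  rcases Nat.eq_zero_or_pos c with rfl | hc
  · lia
  · rw [rowLen_rect hc, hfirst]
    by_cases hj : j < r
    · rw [colLen_rect hj]
      lia
    · lia

variable {P : Type*}

theorem glue_rect (t : Fin c × ZMod r → P) {i j : ℕ}
    (h : (i, j) ∈ (rectShape r c).gluedOuter.cells \ (rectShape r c).gluedInner.cells) :
    (rectShape r c).glue (t ∘ rectCellEquiv r c) ⟨(i, j), h⟩ =
      t (⟨i, (mem_glued_rect.mp h).1⟩, j) := by
  obtain ⟨hi, hj⟩ := mem_glued_rect.mp h
  have hlen : (rectShape r c).outer.rowLen 0 = r := rowLen_rect (Nat.zero_lt_of_lt hi)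
  refine congrArg t ?_
  simp only [CylindricShape.unglue, rectCellEquiv, Equiv.coe_fn_mk, hlen]
  rcases hj.lt_or_eq with hlt | rfl
  · simp [hlt, rectShape]
  · simp

variable [PartialOrder P]

/-- The conditions on a cylindric tableau of shape `(r^c) / ∅ / 0`, its columns being indexed
cyclically. -/
def IsCyclicTableau (t : Fin c × ZMod r → P) : Prop :=
  (∀ j, StrictMono fun i => t (i, j)) ∧ ∀ i j, ¬ t (i, j + 1) < t (i, j)

theorem isCylindricPTableau_rect_iff (t : Fin c × ZMod r → P) :
    IsCylindricPTableau (rectShape r c) (t ∘ rectCellEquiv r c) ↔ IsCyclicTableau t := by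
  simp only [IsCylindricPTableau, IsPTableau, glue_rect]
  refine and_congr ⟨fun h j => ?_, fun h i j hi hi' => h j (Fin.mk_lt_mk.mpr i.lt_succ_self)⟩
    ⟨fun h i j => ?_, fun h i j hi hi' => ?_⟩
  · cases c with
    | zero => exact fun i => i.elim0
    | succ c =>
      refine Fin.strictMono_iff_lt_succ.mpr fun i => ?_
      have hlt := h i j.val (mem_glued_rect.mpr ⟨i.castSucc.2, j.val_lt.le⟩)
        (mem_glued_rect.mpr ⟨i.succ.2, j.val_lt.le⟩)
      rwa [ZMod.natCast_zmod_val] at hlt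
  · simpa using h i j.val (mem_glued_rect.mpr ⟨i.2, j.val_lt.le⟩)
      (mem_glued_rect.mpr ⟨i.2, j.val_lt⟩)
  · simpa using h ⟨i, (mem_glued_rect.mp hi).1⟩ j

end Rectangles

section StandardTableaux

variable {P : Type*} [PartialOrder P] {r c : ℕ}

variable (P r c) in
/-- A standard cylindric tableau of rectangular shape, as a bijection from its boxes. -/
def standardTableauEquiv [NeZero r] :
    StandardCylindricPTableau P (rectShape r c) ≃
      {t : Fin c × ZMod r ≃ P // IsCyclicTableau t} where
  toFun T := ⟨(rectCellEquiv r c).symm.trans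
    (Equiv.ofBijective T.1 ((Function.bijective_iff_existsUnique T.1).mpr T.2.2)), by
      rw [← isCylindricPTableau_rect_iff]
      convert T.2.1
      funext x
      simp⟩
  invFun t := ⟨t.1 ∘ rectCellEquiv r c, (isCylindricPTableau_rect_iff t.1).mpr t.2,
    (Function.bijective_iff_existsUnique _).mp (t.1.bijective.comp (rectCellEquiv r c).bijective)⟩
  left_inv T := Subtype.ext (funext fun x => by simp)
  right_inv t := Subtype.ext (Equiv.ext fun x => by simp)

/-- The columns of a tableau as colour classes. -/
def columnColoring (t : Fin c × ZMod r ≃ P) (ht : IsCyclicTableau t) :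
    (incGraph P).Coloring (ZMod r) :=
  SimpleGraph.Coloring.mk (fun p => (t.symm p).2) fun {p q} hpq h => by
    obtain ⟨⟨i, j⟩, rfl⟩ := t.surjective p
    obtain ⟨⟨i', j'⟩, rfl⟩ := t.surjective q
    obtain rfl : j = j' := by simpa using h
    exact (le_total i i').elim (fun hle => hpq.1 ((ht.1 j).monotone hle))
      fun hle => hpq.2 ((ht.1 j).monotone hle)

theorem columnColoring_apply (t : Fin c × ZMod r ≃ P) (ht : IsCyclicTableau t)
    (x : Fin c × ZMod r) : columnColoring t ht (t x) = x.2 :=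
  congrArg Prod.snd (t.symm_apply_apply x)

variable [Fintype P]

theorem row_columnColoring (t : Fin c × ZMod r ≃ P) (ht : IsCyclicTableau t)
    (x : Fin c × ZMod r) : row (columnColoring t ht) (t x) = x.1 := by
  obtain ⟨i, j⟩ := x
  rw [← Fin.card_Iio i, row]
  refine (Finset.card_nbij (fun i' => t (i', j)) (fun i' hi' => ?_) (fun _ _ _ _ h => ?_)
    fun p hp => ?_).symm
  · simpa [columnColoring_apply] using ht.1 j (by simpa using hi')
  · simpa using h
  · obtain ⟨⟨i', j'⟩, rfl⟩ := t.surjective p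
    obtain ⟨rfl, hlt⟩ : j' = j ∧ t (i', j') < t (i, j) := by
      simpa [columnColoring_apply] using hp
    exact ⟨i', by simpa using (ht.1 j').lt_iff_lt.mp hlt, rfl⟩

theorem columnColoring_flawless (t : Fin c × ZMod r ≃ P) (ht : IsCyclicTableau t) (p : P) :
    ¬ IsFlaw (· - 1) (columnColoring t ht) p := by
  obtain ⟨⟨i, j⟩, rfl⟩ := t.surjective p
  refine (not_isFlaw_iff _ _).mpr ⟨t (i, j - 1), ?_, ?_, ?_⟩
  · rw [columnColoring_apply, columnColoring_apply]
  · rw [row_columnColoring, row_columnColoring]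
  · simpa using ht.2 i (j - 1)

variable [NeZero r]

/-- The positions of the elements of `P` in the tableau whose columns are the colour classes of a
flawless colouring. -/
def positionEquiv (hcard : Fintype.card P = r * c) (κ : (incGraph P).Coloring (ZMod r))
    (hκ : ∀ u, ¬ IsFlaw (· - 1) κ u) : P ≃ Fin c × ZMod r :=
  Equiv.ofBijective
    (fun p => (⟨row κ p, colSize_eq_of_flawless hcard hκ (κ p) ▸ row_lt_colSize κ p⟩, κ p)) <| by
    refine ⟨fun p q h => ?_, fun ⟨i, j⟩ => ?_⟩
    · simp only [Prod.mk.injEq, Fin.mk.injEq] at h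
      exact eq_of_row_eq κ h.2 h.1
    · obtain ⟨p, rfl, hrow⟩ := exists_row_eq κ (c := j) (m := i)
        ((colSize_eq_of_flawless hcard hκ j).symm ▸ i.2)
      exact ⟨p, Prod.ext (Fin.ext hrow) rfl⟩

theorem isCyclicTableau_positionEquiv_symm (hcard : Fintype.card P = r * c)
    (κ : (incGraph P).Coloring (ZMod r)) (hκ : ∀ u, ¬ IsFlaw (· - 1) κ u) :
    IsCyclicTableau (positionEquiv hcard κ hκ).symm := by
  have hposition : ∀ x, κ ((positionEquiv hcard κ hκ).symm x) = x.2 ∧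
      row κ ((positionEquiv hcard κ hκ).symm x) = x.1 := fun x => by
    have h := (positionEquiv hcard κ hκ).apply_symm_apply x
    exact ⟨congrArg Prod.snd h, congrArg (fun x => (x.1 : ℕ)) h⟩
  refine ⟨fun j i i' hlt => lt_of_row_lt_row κ ?_ ?_, fun i j hlt => ?_⟩
  · rw [(hposition _).1, (hposition _).1]
  · rw [(hposition _).2, (hposition _).2]
    exact hlt
  · obtain ⟨v, hv, hrow, hnot⟩ := (not_isFlaw_iff _ κ).mp
      (hκ ((positionEquiv hcard κ hκ).symm (i, j + 1)))
    rw [(hposition _).1, add_sub_cancel_right] at hv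
    rw [(hposition _).2, ← (hposition (i, j)).2] at hrow
    exact hnot (eq_of_row_eq κ (hv.trans (hposition (i, j)).1.symm) hrow ▸ hlt)

theorem positionEquiv_columnColoring (hcard : Fintype.card P = r * c)
    (t : Fin c × ZMod r ≃ P) (ht : IsCyclicTableau t) :
    positionEquiv hcard (columnColoring t ht) (columnColoring_flawless t ht) = t.symm := by
  ext1 p
  obtain ⟨x, rfl⟩ := t.surjective p
  rw [Equiv.symm_apply_apply]
  exact Prod.ext (Fin.ext (row_columnColoring t ht x)) (columnColoring_apply t ht x)

theorem card_standardCylindricPTableau_rect (hcard : Fintype.card P = r * c) :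
    Nat.card (StandardCylindricPTableau P (rectShape r c)) =
      #(flawlessColorings P (· - 1 : ZMod r → ZMod r)) := by
  rw [Nat.card_congr (standardTableauEquiv P r c), ← Nat.card_eq_finsetCard]
  exact Nat.card_congr
    { toFun := fun t => ⟨columnColoring t.1 t.2,
        mem_flawlessColorings.mpr (columnColoring_flawless t.1 t.2)⟩
      invFun := fun κ => ⟨(positionEquiv hcard κ.1 (mem_flawlessColorings.mp κ.2)).symm,
        isCyclicTableau_positionEquiv_symm hcard κ.1 _⟩
      left_inv := fun t =>
        Subtype.ext (congrArg Equiv.symm (positionEquiv_columnColoring hcard t.1 t.2))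
      right_inv := fun _ => rfl }

end StandardTableaux

section Restriction

open MvPolynomial (esymm X)

theorem coeff_elemSymm (k : ℕ) (m : ℕ →₀ ℕ) :
    MvPowerSeries.coeff m (elemSymm k) = if (∀ i, m i ≤ 1) ∧ #m.support = k then 1 else 0 := rfl

variable {ι : Type*}

theorem sum_single_eq_iff {t : Finset ι} {m : ι →₀ ℕ} :
    ∑ i ∈ t, Finsupp.single i 1 = m ↔ (∀ i, m i ≤ 1) ∧ m.support = t := by
  have happly : ∀ i, (∑ j ∈ t, Finsupp.single j 1 : ι →₀ ℕ) i = if i ∈ t then 1 else 0 :=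
    fun i => by simp [Finsupp.finsetSum_apply, Finsupp.single_apply]
  simp only [Finsupp.ext_iff, happly, Finset.ext_iff, Finsupp.mem_support_iff, ← forall_and]
  refine forall_congr' fun i => ?_
  by_cases hi : i ∈ t <;> simp only [hi, if_true, if_false, iff_true, iff_false] <;> lia

variable {V : Type*}

theorem exists_recolorOfEmbedding_eq {G : SimpleGraph V} {C : Type*} (e : ι ↪ C)
    (κ : G.Coloring C) (h : ∀ v, κ v ∈ Set.range e) : ∃ κ', G.recolorOfEmbedding e κ' = κ := by
  choose f hf using h
  refine ⟨SimpleGraph.Coloring.mk f fun {v w} hadj hvw => κ.valid hadj ?_,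
    RelHom.ext fun v => hf v⟩
  rw [← hf v, hvw, hf w]

variable [Fintype V]

theorem mem_support_weight {f : V → ℕ} {i : ℕ} : i ∈ (weight f).support ↔ ∃ v, f v = i := by
  simp [weight, Finsupp.finsetSum_apply, Finsupp.single_apply]

theorem weight_recolorOfEmbedding {G : SimpleGraph V} (e : ι ↪ ℕ) (κ : G.Coloring ι) :
    weight (G.recolorOfEmbedding e κ) = (∑ v, Finsupp.single (κ v) 1 : ι →₀ ℕ).embDomain e := by
  rw [Finsupp.embDomain_eq_mapDomain, Finsupp.mapDomain_finsetSum]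
  simp [weight, Finsupp.mapDomain_single]

variable [Fintype ι]

theorem killCompl_elemSymm (e : ι ↪ ℕ) (k : ℕ) :
    MvPowerSeries.killCompl e (elemSymm k) = (esymm ι ℤ k : MvPowerSeries ι ℤ) := by
  ext m
  have hle : (∀ i, m.embDomain e i ≤ 1) ↔ ∀ i, m i ≤ 1 := by
    refine ⟨fun h i => Finsupp.embDomain_apply_self e m i ▸ h (e i), fun h i => ?_⟩
    rw [Finsupp.embDomain_apply]
    split_ifs
    exacts [h _, zero_le_one]
  simp only [MvPowerSeries.coeff_killCompl, coeff_elemSymm, hle, Finsupp.support_embDomain,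
    Finset.card_map, MvPolynomial.coeff_coe, MvPolynomial.esymm_eq_sum_monomial,
    MvPolynomial.coeff_sum, MvPolynomial.coeff_monomial, sum_single_eq_iff]
  by_cases h : ∀ i, m i ≤ 1
  · simp [h, Finset.mem_powersetCard]
  · simp [h]

theorem killCompl_elemSymmPart (e : ι ↪ ℕ) (lam : YoungDiagram) :
    MvPowerSeries.killCompl e (elemSymmPart lam) =
      ((lam.rowLens.map (esymm ι ℤ)).prod : MvPolynomial ι ℤ) := by
  rw [elemSymmPart, map_list_prod, List.map_map,
    ← MvPolynomial.coeToMvPowerSeries.ringHom_apply, map_list_prod, List.map_map]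
  exact congrArg List.prod (List.map_congr_left fun k _ => killCompl_elemSymm e k)

/-- The chromatic symmetric polynomial, with variables indexed by the finite set of colours. -/
def chromaticPoly (G : SimpleGraph V) (ι : Type*) [Fintype ι] : MvPolynomial ι ℤ :=
  ∑ κ : G.Coloring ι, ∏ v, X (κ v)

theorem chromaticPoly_isSymmetric (G : SimpleGraph V) : (chromaticPoly G ι).IsSymmetric := by
  intro σ
  simp only [chromaticPoly, map_sum, map_prod, MvPolynomial.rename_X]
  exact sum_coloring_comp_perm G σ X

theorem killCompl_chromaticSymm (G : SimpleGraph V) (e : ι ↪ ℕ) :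
    MvPowerSeries.killCompl e (chromaticSymm G) = (chromaticPoly G ι : MvPowerSeries ι ℤ) := by
  ext m
  simp only [MvPowerSeries.coeff_killCompl, MvPolynomial.coeff_coe, chromaticPoly,
    MvPolynomial.coeff_sum, X, ← MvPolynomial.monomial_sum_one, MvPolynomial.coeff_monomial,
    Finset.sum_boole]
  rw [← Fintype.card_subtype, ← Nat.card_eq_fintype_card]
  refine congrArg Nat.cast (Nat.card_congr (Equiv.ofBijective
    (fun κ => ⟨G.recolorOfEmbedding e κ.1, by rw [weight_recolorOfEmbedding, κ.2]⟩)
    ⟨fun κ κ' h => ?_, fun ⟨κ, hκ⟩ => ?_⟩)).symm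
  · exact Subtype.ext ((G.recolorOfEmbedding e).injective (congrArg Subtype.val h))
  · obtain ⟨κ', rfl⟩ := exists_recolorOfEmbedding_eq e κ fun v => by
      have hv : κ v ∈ (weight κ).support := mem_support_weight.mpr ⟨v, rfl⟩
      rw [hκ, Finsupp.support_embDomain, Finset.mem_map] at hv
      exact hv.imp fun _ h => h.2
    rw [weight_recolorOfEmbedding, Finsupp.embDomain_inj] at hκ
    exact ⟨⟨κ', hκ⟩, rfl⟩

end Restriction

section ElementaryProducts

open MvPolynomial (aeval esymm esymmAlgHom monomial rename)

theorem eq_of_rowLens_perm {lam mu : YoungDiagram} (h : lam.rowLens.Perm mu.rowLens) :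
    lam = mu :=
  YoungDiagram.equivListRowLens.injective
    (Subtype.ext (h.eq_of_sortedGE lam.rowLens_sorted mu.rowLens_sorted))

theorem map_succ_map_pred_rowLens (lam : YoungDiagram) :
    ((lam.rowLens : Multiset ℕ).map Nat.pred).map Nat.succ = lam.rowLens := by
  rw [Multiset.map_map]
  refine (Multiset.map_congr rfl fun k hk => ?_).trans (Multiset.map_id _)
  exact Nat.succ_pred_eq_of_pos (lam.pos_of_mem_rowLens k hk)

/-- The exponent vector that records a partition: its entry at `i` is the number of parts equal to
`i + 1`. -/
def partExponents : YoungDiagram ≃ (ℕ →₀ ℕ) where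
  toFun lam := Multiset.toFinsupp ((lam.rowLens : Multiset ℕ).map Nat.pred)
  invFun d := YoungDiagram.ofRowLens (((Finsupp.toMultiset d).map Nat.succ).sort (· ≥ ·))
    (Multiset.pairwise_sort _ _).sortedGE
  left_inv lam := by
    refine eq_of_rowLens_perm ?_
    rw [YoungDiagram.rowLens_ofRowLens_eq_self (by simp), ← Multiset.coe_eq_coe,
      Multiset.sort_eq, Multiset.toFinsupp_toMultiset, map_succ_map_pred_rowLens]
  right_inv d := by
    beta_reduce
    rw [YoungDiagram.rowLens_ofRowLens_eq_self (by simp), Multiset.sort_eq, Multiset.map_map]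
    simp

/-- The algebra map that substitutes `e_{i + 1}` for the variable `i`. -/
def elemSymmHom : MvPolynomial ℕ ℤ →ₐ[ℤ] MvPowerSeries ℕ ℤ := aeval fun i => elemSymm (i + 1)

theorem elemSymmHom_monomial_partExponents (lam : YoungDiagram) :
    elemSymmHom (monomial (partExponents lam) 1) = elemSymmPart lam := by
  have hparts : ((lam.rowLens : Multiset ℕ).map elemSymm).prod = elemSymmPart lam := by
    rw [Multiset.map_coe, Multiset.prod_coe, elemSymmPart]
  rw [← hparts, ← map_succ_map_pred_rowLens, Multiset.map_map, Finset.prod_multiset_map_count,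
    elemSymmHom, MvPolynomial.aeval_monomial, map_one, one_mul]
  rfl

theorem killCompl_elemSymmHom {ι : Type*} [Fintype ι] (e : ι ↪ ℕ) (p : MvPolynomial ℕ ℤ) :
    MvPowerSeries.killCompl e (elemSymmHom p) =
      (aeval (fun i => esymm ι ℤ (i + 1)) p : MvPolynomial ι ℤ) := by
  have hhom : (MvPowerSeries.killCompl e).comp elemSymmHom =
      (MvPolynomial.coeToMvPowerSeries.algHom ℤ).comp (aeval fun i => esymm ι ℤ (i + 1)) := by
    ext1 i
    simp [elemSymmHom, killCompl_elemSymm]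
  simpa using DFunLike.congr_fun hhom p

theorem killCompl_elemSymmHom_rename {ι : Type*} [Fintype ι] (e : ι ↪ ℕ) {n : ℕ}
    (q : MvPolynomial (Fin n) ℤ) :
    MvPowerSeries.killCompl e (elemSymmHom (rename Fin.val q)) =
      ((esymmAlgHom ι ℤ n q).1 : MvPowerSeries ι ℤ) := by
  rw [killCompl_elemSymmHom, MvPolynomial.aeval_rename, MvPolynomial.esymmAlgHom_apply]
  rfl

theorem elemSymmHom_injective : Function.Injective elemSymmHom := by
  refine (injective_iff_map_eq_zero _).mpr fun p hp => ?_
  obtain ⟨n, hn⟩ := p.vars.exists_nat_subset_range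
  obtain ⟨q, rfl⟩ := MvPolynomial.exists_rename_eq_of_vars_subset_range p (Fin.val : Fin n → ℕ)
    Fin.val_injective fun i hi => ⟨⟨i, Finset.mem_range.mp (hn hi)⟩, rfl⟩
  have hrestrict := killCompl_elemSymmHom_rename (Fin.valEmbedding (n := n)) q
  rw [hp, map_zero, ← MvPolynomial.coe_zero, MvPolynomial.coe_inj] at hrestrict
  have hq : esymmAlgHom (Fin n) ℤ n q = 0 := Subtype.ext hrestrict.symm
  rw [(map_eq_zero_iff _ (MvPolynomial.esymmAlgHom_injective ℤ (by simp))).mp hq, map_zero]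

theorem isElemExpansion_iff {f : MvPowerSeries ℕ ℤ} {a : YoungDiagram →₀ ℤ} :
    IsElemExpansion f a ↔
      elemSymmHom (((MvPolynomial.basisMonomials ℕ ℤ).reindex partExponents.symm).repr.symm a) =
        f := by
  rw [IsElemExpansion, eq_comm, Module.Basis.repr_symm_apply, Finsupp.linearCombination_apply,
    map_finsuppSum]
  simp [elemSymmHom_monomial_partExponents]

theorem IsElemExpansion.unique {f : MvPowerSeries ℕ ℤ} {a b : YoungDiagram →₀ ℤ}
    (ha : IsElemExpansion f a) (hb : IsElemExpansion f b) : a = b := by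
  rw [isElemExpansion_iff] at ha hb
  exact LinearEquiv.injective _ (elemSymmHom_injective (ha.trans hb.symm))

theorem exists_isElemExpansion_elemSymmHom (p : MvPolynomial ℕ ℤ) :
    ∃ a, IsElemExpansion (elemSymmHom p) a :=
  ⟨_, isElemExpansion_iff.mpr (congrArg elemSymmHom (LinearEquiv.symm_apply_apply _ p))⟩

end ElementaryProducts

section Homogeneity

theorem card_support_le_degree {ι : Type*} (m : ι →₀ ℕ) : #m.support ≤ m.degree := by
  simpa [Finsupp.degree_apply] using Finset.card_nsmul_le_sum m.support m 1 fun i hi =>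
    Nat.one_le_iff_ne_zero.mpr (Finsupp.mem_support_iff.mp hi)

theorem elemSymm_isHomogeneous (k : ℕ) : (elemSymm k).IsHomogeneous k := by
  intro m hm
  obtain ⟨hle, rfl⟩ : (∀ i, m i ≤ 1) ∧ #m.support = k := by
    rw [coeff_elemSymm] at hm
    by_contra h
    exact hm (if_neg h)
  refine (Finsupp.degree_eq_weight_one (R := ℕ) ▸ rfl : Finsupp.weight 1 m = m.degree).trans
    (le_antisymm ?_ (card_support_le_degree m))
  simpa [Finsupp.degree_apply] using Finset.sum_le_card_nsmul m.support m 1 fun i _ => hle i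

theorem elemSymmPart_isHomogeneous (lam : YoungDiagram) :
    (elemSymmPart lam).IsHomogeneous lam.rowLens.sum := by
  rw [elemSymmPart]
  induction lam.rowLens with
  | nil =>
    intro m hm
    obtain rfl : m = 0 := by
      by_contra hne
      exact hm (by simp [MvPowerSeries.coeff_one, hne])
    simp
  | cons k l ih =>
    rw [List.map_cons, List.prod_cons, List.sum_cons]
    exact MvPowerSeries.IsHomogeneous.mul (elemSymm_isHomogeneous k) ih

theorem chromaticSymm_isHomogeneous {V : Type*} [Fintype V] (G : SimpleGraph V) :
    (chromaticSymm G).IsHomogeneous (Fintype.card V) := by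
  intro m hm
  obtain ⟨κ, rfl⟩ : ∃ κ : G.Coloring ℕ, weight κ = m := by
    by_contra! h
    have hempty : IsEmpty {κ : G.Coloring ℕ // weight κ = m} := ⟨fun κ => h κ.1 κ.2⟩
    exact hm (by simp [chromaticSymm, MvPowerSeries.coeff_apply])
  simp [weight, Finsupp.weight_single]

theorem homogeneousComponent_of_isHomogeneous {σ R : Type*} [CommSemiring R]
    {f : MvPowerSeries σ R} {k : ℕ} (hf : f.IsHomogeneous k) (n : ℕ) :
    f.homogeneousComponent n = if k = n then f else 0 := by
  split_ifs with h
  · exact (MvPowerSeries.isHomogeneous_iff_eq_homogeneousComponent.mp (h ▸ hf)).symm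
  · ext m
    rw [MvPowerSeries.coeff_homogeneousComponent]
    split_ifs with hm
    · exact MvPowerSeries.IsHomogeneous.coeff_eq_zero hf fun hk => h (hk.symm.trans hm)
    · rfl

theorem IsElemExpansion.homogeneousComponent {f : MvPowerSeries ℕ ℤ} {a : YoungDiagram →₀ ℤ}
    (ha : IsElemExpansion f a) (n : ℕ) :
    IsElemExpansion (f.homogeneousComponent n) (a.filter fun lam => lam.rowLens.sum = n) := by
  rw [IsElemExpansion, ha, map_finsuppSum, Finsupp.sum_filter_index, Finsupp.sum,
    Finsupp.support_filter, Finset.sum_filter]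
  refine Finset.sum_congr rfl fun lam _ => ?_
  rw [map_zsmul, homogeneousComponent_of_isHomogeneous (elemSymmPart_isHomogeneous lam), smul_ite,
    smul_zero]

theorem IsElemExpansion.sum_rowLens_eq {f : MvPowerSeries ℕ ℤ} {a : YoungDiagram →₀ ℤ}
    (ha : IsElemExpansion f a) {n : ℕ} (hf : f.IsHomogeneous n) {lam : YoungDiagram}
    (hlam : a lam ≠ 0) : lam.rowLens.sum = n := by
  have hfilter := ha.homogeneousComponent n
  rw [← MvPowerSeries.isHomogeneous_iff_eq_homogeneousComponent.mp hf] at hfilter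
  rw [ha.unique hfilter] at hlam
  by_contra h
  exact hlam (Finsupp.filter_apply_neg _ _ h)

theorem exists_embDomain_eq {n : ℕ} {m : ℕ →₀ ℕ} (hm : #m.support ≤ n) :
    ∃ (e : Fin n ↪ ℕ) (m' : Fin n →₀ ℕ), m'.embDomain e = m := by
  obtain ⟨t, hsupport, hcard⟩ := Infinite.exists_superset_card_eq m.support n hm
  refine ⟨(t.orderEmbOfFin hcard).toEmbedding, _, Finsupp.embDomain_comapDomain ?_⟩
  simpa using hsupport

theorem homogeneousComponent_eq_of_killCompl_eq {f g : MvPowerSeries ℕ ℤ} {n : ℕ}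
    (h : ∀ e : Fin n ↪ ℕ, MvPowerSeries.killCompl e f = MvPowerSeries.killCompl e g) :
    f.homogeneousComponent n = g.homogeneousComponent n := by
  ext m
  simp only [MvPowerSeries.coeff_homogeneousComponent]
  split_ifs with hm
  · obtain ⟨e, m', rfl⟩ := exists_embDomain_eq ((card_support_le_degree m).trans_eq hm)
    simp only [← MvPowerSeries.coeff_killCompl, h]
  · rfl

theorem exists_isElemExpansion {f : MvPowerSeries ℕ ℤ} {n : ℕ} (hf : f.IsHomogeneous n)
    {p : MvPolynomial (Fin n) ℤ} (hp : p.IsSymmetric)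
    (hfp : ∀ e : Fin n ↪ ℕ, MvPowerSeries.killCompl e f = (p : MvPowerSeries (Fin n) ℤ)) :
    ∃ a, IsElemExpansion f a := by
  obtain ⟨q, hq⟩ := MvPolynomial.esymmAlgHom_surjective ℤ (σ := Fin n) (n := n) (by simp) ⟨p, hp⟩
  obtain ⟨a, ha⟩ := exists_isElemExpansion_elemSymmHom (MvPolynomial.rename Fin.val q)
  have hcomponent : f.homogeneousComponent n =
      (elemSymmHom (MvPolynomial.rename Fin.val q)).homogeneousComponent n :=
    homogeneousComponent_eq_of_killCompl_eq fun e => by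
      rw [hfp, killCompl_elemSymmHom_rename, hq]
  rw [MvPowerSeries.isHomogeneous_iff_eq_homogeneousComponent.mp hf, hcomponent]
  exact ⟨_, ha.homogeneousComponent n⟩

theorem exists_isElemExpansion_chromaticSymm {V : Type*} [Fintype V] (G : SimpleGraph V) :
    ∃ a, IsElemExpansion (chromaticSymm G) a :=
  exists_isElemExpansion (chromaticSymm_isHomogeneous G) (chromaticPoly_isSymmetric G)
    (killCompl_chromaticSymm G)

end Homogeneity

section RootsOfUnity

open MvPolynomial (aeval esymm X)

theorem esymm_card (ι R : Type*) [Fintype ι] [CommSemiring R] :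
    esymm ι R (Fintype.card ι) = ∏ i, X i := by
  rw [esymm, ← Finset.card_univ, Finset.powersetCard_self, Finset.sum_singleton]

theorem esymm_eq_zero_of_card_lt {ι R : Type*} [Fintype ι] [CommSemiring R] {k : ℕ}
    (hk : Fintype.card ι < k) : esymm ι R k = 0 := by
  rw [esymm, Finset.powersetCard_eq_empty.mpr hk, Finset.sum_empty]

theorem aeval_mul_esymm {ι R K : Type*} [Fintype ι] [CommSemiring R] [CommSemiring K] [Algebra R K]
    (t : K) (z : ι → K) (k : ℕ) :
    aeval (fun i => t * z i) (esymm ι R k) = t ^ k * aeval z (esymm ι R k) := by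
  simp only [esymm, map_sum, map_prod, MvPolynomial.aeval_X, Finset.mul_sum]
  refine Finset.sum_congr rfl fun s hs => ?_
  rw [Finset.prod_mul_distrib, Finset.prod_const, (Finset.mem_powersetCard.mp hs).2]

variable {r : ℕ} [NeZero r] {K : Type*} [CommRing K] [IsDomain K] {ψ : AddChar (ZMod r) K}

theorem aeval_addChar_esymm_eq_zero (hψ : ψ.IsPrimitive) {k : ℕ} (hk : 0 < k) (hkr : k ≠ r) :
    aeval ψ (esymm (ZMod r) ℤ k) = 0 := by
  rcases hkr.lt_or_gt with hlt | hgt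
  · have hrotate : aeval ψ (esymm (ZMod r) ℤ k) = ψ k * aeval ψ (esymm (ZMod r) ℤ k) := by
      conv_lhs => rw [← MvPolynomial.rename_esymm (ZMod r) ℤ k (Equiv.addLeft 1),
        MvPolynomial.aeval_rename]
      rw [← nsmul_one k, ψ.map_nsmul_eq_pow, ← aeval_mul_esymm]
      simp only [Function.comp_def, Equiv.coe_addLeft, ψ.map_add_eq_mul]
    have hne : ψ k ≠ 1 := by
      rw [Ne, hψ.zmod_char_eq_one_iff, ZMod.natCast_eq_zero_iff]
      exact Nat.not_dvd_of_pos_of_lt hk hlt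
    by_contra hzero
    exact hne (mul_right_cancel₀ hzero (by rw [one_mul, ← hrotate]))
  · rw [esymm_eq_zero_of_card_lt (by rwa [ZMod.card]), map_zero]

theorem rowLens_rect (r c : ℕ) [NeZero r] : (rect r c).rowLens = List.replicate c r := by
  refine List.ext_get (by simp [colLen_rect (NeZero.pos r)]) fun i hi hi' => ?_
  simpa using rowLen_rect (by simpa using hi')

theorem eq_rect_of_forall_mem_rowLens_eq {lam : YoungDiagram} {c : ℕ}
    (hsum : lam.rowLens.sum = r * c) (h : ∀ k ∈ lam.rowLens, k = r) : lam = rect r c := by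
  have hreplicate := List.eq_replicate_of_mem h
  have hlength : lam.rowLens.length = c := by
    rw [hreplicate, List.sum_replicate, smul_eq_mul, mul_comm] at hsum
    exact Nat.eq_of_mul_eq_mul_left (NeZero.pos r) hsum
  refine eq_of_rowLens_perm (.of_eq ?_)
  rw [rowLens_rect, hreplicate, hlength]

theorem prod_aeval_addChar_esymm (hψ : ψ.IsPrimitive) {lam : YoungDiagram} {c : ℕ}
    (hsum : lam.rowLens.sum = r * c) :
    (lam.rowLens.map fun k => aeval ψ (esymm (ZMod r) ℤ k)).prod =
      if lam = rect r c then (∏ i, ψ i) ^ c else 0 := by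
  split_ifs with h
  · rw [h, rowLens_rect, List.map_replicate, List.prod_replicate]
    congr 1
    simpa using congrArg (aeval ψ) (esymm_card (ZMod r) ℤ)
  · rw [List.prod_eq_zero_iff, List.mem_map]
    by_contra! hne
    refine h (eq_rect_of_forall_mem_rowLens_eq hsum fun k hk => ?_)
    by_contra hkr
    exact hne k hk (aeval_addChar_esymm_eq_zero hψ (lam.pos_of_mem_rowLens k hk) hkr)

theorem IsElemExpansion.chromaticPoly_eq {V : Type*} [Fintype V] {G : SimpleGraph V}
    {a : YoungDiagram →₀ ℤ} (ha : IsElemExpansion (chromaticSymm G) a) {ι : Type*} [Fintype ι]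
    (e : ι ↪ ℕ) :
    chromaticPoly G ι = a.sum fun lam z => z • (lam.rowLens.map (esymm ι ℤ)).prod := by
  rw [← MvPolynomial.coe_inj, ← killCompl_chromaticSymm G e, ha, map_finsuppSum,
    ← MvPolynomial.coeToMvPowerSeries.ringHom_apply, map_finsuppSum]
  refine Finsupp.sum_congr fun lam _ => ?_
  rw [map_zsmul, map_zsmul, killCompl_elemSymmPart,
    MvPolynomial.coeToMvPowerSeries.ringHom_apply]

theorem IsElemExpansion.sum_coloring_addChar {V : Type*} [Fintype V] {G : SimpleGraph V}
    {a : YoungDiagram →₀ ℤ} (ha : IsElemExpansion (chromaticSymm G) a) (hψ : ψ.IsPrimitive)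
    {c : ℕ} (hcard : Fintype.card V = r * c) :
    ∑ κ : G.Coloring (ZMod r), ∏ v, ψ (κ v) = a (rect r c) * (∏ i, ψ i) ^ c := by
  have hpoly := congrArg (aeval ψ)
    (ha.chromaticPoly_eq ⟨ZMod.val (n := r), ZMod.val_injective r⟩)
  simp only [chromaticPoly, map_sum, map_prod, MvPolynomial.aeval_X] at hpoly
  have hterm : ∀ lam ∈ a.support, aeval ψ (a lam • (lam.rowLens.map (esymm (ZMod r) ℤ)).prod) =
      if lam = rect r c then a lam * (∏ i, ψ i) ^ c else 0 := fun lam hlam => by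
    have hsum := (ha.sum_rowLens_eq (chromaticSymm_isHomogeneous G)
      (Finsupp.mem_support_iff.mp hlam)).trans hcard
    rw [map_zsmul, map_list_prod, List.map_map, zsmul_eq_mul, ← mul_ite_zero,
      ← prod_aeval_addChar_esymm hψ hsum]
    rfl
  rw [hpoly, map_finsuppSum, Finsupp.sum, Finset.sum_congr rfl hterm, Finset.sum_ite_eq']
  refine ite_eq_left_iff.mpr fun hrect => ?_
  rw [Finsupp.notMem_support_iff.mp hrect, Int.cast_zero, zero_mul]

end RootsOfUnity

section RectangleCoefficient

variable {P : Type*} [PartialOrder P] [Fintype P]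

theorem StandardCylindricPTableau.card_eq {r c : ℕ} [NeZero r]
    (T : StandardCylindricPTableau P (rectShape r c)) : Fintype.card P = r * c := by
  have hbij : Function.Bijective T.1 := (Function.bijective_iff_existsUnique _).mpr T.2.2
  rw [← Fintype.card_of_bijective hbij, Fintype.card_congr (rectCellEquiv r c),
    Fintype.card_prod, Fintype.card_fin, ZMod.card, mul_comm]

theorem rect_zero_left (c : ℕ) : rect 0 c = rect 1 0 :=
  YoungDiagram.ext (by simp [rect])

theorem rectShape_zero_left (c : ℕ) : rectShape 0 c = rectShape 1 0 := by
  simp only [rectShape, rect_zero_left]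

theorem IsElemExpansion.apply_rect_of_card_eq (hP : ThreePlusOneFree P) {a : YoungDiagram →₀ ℤ}
    (ha : IsElemExpansion (chromaticSymm (incGraph P)) a) {r c : ℕ} [NeZero r]
    (hcard : Fintype.card P = r * c) :
    a (rect r c) = Nat.card (StandardCylindricPTableau P (rectShape r c)) := by
  have hψ := ZMod.isPrimitive_stdAddChar r
  have hprod : (∏ i : ZMod r, ZMod.stdAddChar i : ℂ) ^ c ≠ 0 :=
    pow_ne_zero c (Finset.prod_ne_zero_iff.mpr fun i _ =>
      (ZMod.stdAddChar.val_isUnit i).ne_zero)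
  have hsums := (ha.sum_coloring_addChar hψ hcard).symm.trans
    (sum_incGraph_coloring_addChar hψ hP hcard)
  rw [card_standardCylindricPTableau_rect hcard]
  exact_mod_cast mul_right_cancel₀ hprod hsums

theorem IsElemExpansion.apply_rect (hP : ThreePlusOneFree P) {a : YoungDiagram →₀ ℤ}
    (ha : IsElemExpansion (chromaticSymm (incGraph P)) a) (r c : ℕ) :
    a (rect r c) = Nat.card (StandardCylindricPTableau P (rectShape r c)) := by
  wlog hr : NeZero r generalizing r c
  · obtain rfl := not_neZero.mp hr
    rw [rect_zero_left, rectShape_zero_left]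
    exact this 1 0 inferInstance
  by_cases hcard : Fintype.card P = r * c
  · exact ha.apply_rect_of_card_eq hP hcard
  · have : IsEmpty (StandardCylindricPTableau P (rectShape r c)) := ⟨fun T => hcard T.card_eq⟩
    rw [Nat.card_of_isEmpty, Nat.cast_zero]
    by_contra hne
    have hsum := ha.sum_rowLens_eq (chromaticSymm_isHomogeneous _) hne
    rw [rowLens_rect, List.sum_replicate, smul_eq_mul, mul_comm] at hsum
    exact hcard hsum.symm

end RectangleCoefficient

section CylindricSchur

theorem card_orderEmbedding_fin_map_univ_eq {α : Type*} [LinearOrder α] (s : Finset α) (c : ℕ) :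
    Nat.card {t : Fin c ↪o α // Finset.univ.map t.toEmbedding = s} = if #s = c then 1 else 0 := by
  split_ifs with hs
  · have hunique : ∀ t : Fin c ↪o α, Finset.univ.map t.toEmbedding = s → t = s.orderEmbOfFin hs :=
      fun t ht => Finset.orderEmbOfFin_unique' hs fun i => by
        rw [← ht]
        exact Finset.mem_map_of_mem t.toEmbedding (Finset.mem_univ i)
    exact Nat.card_eq_one_iff_unique.mpr
      ⟨⟨fun t t' => Subtype.ext ((hunique t t.2).trans (hunique t' t'.2).symm)⟩,
        ⟨s.orderEmbOfFin hs, s.map_orderEmbOfFin_univ hs⟩⟩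
  · have : IsEmpty {t : Fin c ↪o α // Finset.univ.map t.toEmbedding = s} :=
      ⟨fun t => hs (by rw [← t.2, Finset.card_map, Finset.card_fin])⟩
    exact Nat.card_of_isEmpty

variable {r c : ℕ} [NeZero r] {m : ℕ →₀ ℕ}

theorem isCyclicTableau_nat_iff {T : Fin c × ZMod r → ℕ} :
    IsCyclicTableau T ↔ ∃ t : Fin c ↪o ℕ, t ∘ Prod.fst = T := by
  constructor
  · rintro ⟨hcolumn, hrow⟩
    refine ⟨OrderEmbedding.ofStrictMono _ (hcolumn 0), funext fun ⟨i, j⟩ => ?_⟩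
    have hle := apply_le_apply_of_forall_add_one_le
      (f := fun j => OrderDual.toDual (T (i, j))) fun j => not_lt.mp (hrow i j)
    exact le_antisymm (hle j 0) (hle 0 j)
  · rintro ⟨t, rfl⟩
    exact ⟨fun _ => t.strictMono, fun _ _ => lt_irrefl _⟩

theorem weight_comp_fst_comp_rectCellEquiv (t : Fin c → ℕ) :
    weight ((t ∘ Prod.fst) ∘ rectCellEquiv r c) = r • weight t := by
  calc weight ((t ∘ Prod.fst) ∘ rectCellEquiv r c)
      = ∑ x : Fin c × ZMod r, Finsupp.single (t x.1) 1 :=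
        (rectCellEquiv r c).sum_comp fun x => Finsupp.single (t x.1) 1
    _ = r • weight t := by
        simp only [Fintype.sum_prod_type, Finset.sum_const, Finset.card_univ, ZMod.card, weight,
          Finset.smul_sum]

theorem card_semistandard_rect :
    Nat.card {T : SkewCell (rectShape r c).outer (rectShape r c).inner → ℕ //
      IsCylindricPTableau (rectShape r c) T ∧ weight T = m} =
    Nat.card {t : Fin c ↪o ℕ // r • weight t = m} := by
  refine (Nat.card_congr (Equiv.ofBijective (fun t => ⟨(t.1 ∘ Prod.fst) ∘ rectCellEquiv r c,
    (isCylindricPTableau_rect_iff _).mpr (isCyclicTableau_nat_iff.mpr ⟨t.1, rfl⟩),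
    (weight_comp_fst_comp_rectCellEquiv t.1).trans t.2⟩) ⟨fun t t' h => ?_, ?_⟩)).symm
  · have hcomp : t.1 ∘ Prod.fst = t'.1 ∘ Prod.fst :=
      (rectCellEquiv r c).surjective.injective_comp_right (congrArg Subtype.val h)
    exact Subtype.ext (DFunLike.coe_injective (Prod.fst_surjective.injective_comp_right hcomp))
  · rintro ⟨T, hT, hm⟩
    obtain ⟨T, rfl⟩ := (rectCellEquiv r c).injective.surjective_comp_right T
    obtain ⟨t, rfl⟩ := isCyclicTableau_nat_iff.mp ((isCylindricPTableau_rect_iff T).mp hT)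
    exact ⟨⟨t, (weight_comp_fst_comp_rectCellEquiv t).symm.trans hm⟩, rfl⟩

theorem smul_weight_eq_iff (t : Fin c ↪o ℕ) :
    r • weight t = m ↔ Finset.univ.map t.toEmbedding = m.support ∧ ∀ x ∈ m.support, m x = r := by
  have happly : ∀ x, (r • weight t) x = if x ∈ Finset.univ.map t.toEmbedding then r else 0 := by
    have hweight : weight t = ∑ x ∈ Finset.univ.map t.toEmbedding, Finsupp.single x 1 := by
      rw [Finset.sum_map]
      rfl
    intro x
    simp only [Finsupp.smul_apply, hweight, Finsupp.finsetSum_apply, Finsupp.single_apply,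
      Finset.sum_ite_eq', smul_eq_mul, mul_ite, mul_one, mul_zero]
  simp only [Finsupp.ext_iff, happly, Finset.ext_iff, Finsupp.mem_support_iff, ← forall_and]
  have hr := NeZero.ne r
  refine forall_congr' fun x => ?_
  split_ifs with hx <;> simp only [hx, true_iff, false_iff] <;> lia

theorem map_support_eq_rowLens_rect_iff :
    m.support.val.map m = ((rect r c).rowLens : Multiset ℕ) ↔
      #m.support = c ∧ ∀ x ∈ m.support, m x = r := by
  rw [rowLens_rect, Multiset.coe_replicate, Multiset.eq_replicate, Multiset.card_map,
    Finset.card_val]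
  simp only [Multiset.mem_map, Finset.mem_val, forall_exists_index, and_imp,
    forall_apply_eq_imp_iff₂]

theorem cylindricSchur_rect (r c : ℕ) :
    cylindricSchur (rectShape r c) = monoSymm (rect r c) := by
  wlog hr : NeZero r generalizing r c
  · obtain rfl := not_neZero.mp hr
    rw [rect_zero_left, rectShape_zero_left]
    exact this 1 0 inferInstance
  funext m
  simp only [cylindricSchur, monoSymm, card_semistandard_rect, smul_weight_eq_iff,
    map_support_eq_rowLens_rect_iff]
  by_cases hm : ∀ x ∈ m.support, m x = r
  · simpa only [and_iff_left hm, Nat.cast_ite, Nat.cast_one, Nat.cast_zero] using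
      congrArg (Nat.cast : ℕ → ℤ) (card_orderEmbedding_fin_map_univ_eq m.support c)
  · simp only [hm, and_false, if_false, Nat.card_of_isEmpty, Nat.cast_zero]

end CylindricSchur

end CylPTab

end

theorem mainTheorem3 {P : Type*} [PartialOrder P] [Fintype P]
    (hP : CylPTab.ThreePlusOneFree P) :
    (∃! a : YoungDiagram →₀ ℤ,
      CylPTab.IsElemExpansion (CylPTab.chromaticSymm (CylPTab.incGraph P)) a) ∧
    (∀ a : YoungDiagram →₀ ℤ,
      CylPTab.IsElemExpansion (CylPTab.chromaticSymm (CylPTab.incGraph P)) a →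
      ∀ r c : ℕ, a (CylPTab.rect r c) =
        (Nat.card (CylPTab.StandardCylindricPTableau P (CylPTab.rectShape r c)) : ℤ)) ∧
    (∀ r c : ℕ, CylPTab.cylindricSchur (CylPTab.rectShape r c) =
      CylPTab.monoSymm (CylPTab.rect r c)) := by
  refine ⟨?_, fun a ha => ha.apply_rect hP, CylPTab.cylindricSchur_rect⟩
  obtain ⟨a, ha⟩ := CylPTab.exists_isElemExpansion_chromaticSymm (CylPTab.incGraph P)
  exact ⟨a, ha, fun b hb => hb.unique ha⟩
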